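/- Let $M_0$ be a finite connected matroid without loops or multiple points (parallel pairs) and with at least two points, let $E_0$ be its ground set, and let $n\ge 3$. (Connected means that any two distinct points lie on a common circuit.) Let $C_n$ be the polygon matroid of the $n$-cycle, that is, the matroid on $n$ points whose only circuit is the set of all $n$ points, with ground set disjoint from $E_0$. Let $S$ be an isthmus (the matroid of rank one on a single point). For any point $i$ of $C_n$ and any $\epsilon_0\in E_0$, let $P(C_n,M_0)$ be the parallel connection of $C_n$ and $M_0$ along $i$ and $\epsilon_0$: its ground set is the disjoint union of the two ground sets with $i$ and $\epsilon_0$ identified, and its circuits are the images of the circuits of $C_n$, the images of the circuits of $M_0$, and the images of the sets $(C\setminus\{i\})\cup(C'\setminus\{\epsilon_0\})$ for circuits $C\ni i$ of $C_n$ and $C'\ni\epsilon_0$ of $M_0$. Put $$M_n=C_n\oplus M_0,\qquad M'_n=P(C_n,M_0)\oplus S .$$ Then: 1. $M_n$ and $M'_n$ both have rank $\operatorname{rk}(M_0)+n-1$. 2. $M_0$ is a submatroid of $M_n$ and of $M'_n$: the restriction of each of them to (the image of) $E_0$ is $M_0$. 3. For every commutative ring $R$, the Orlik–Solomon algebras $A(M_n)$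 and $A(M'_n)$ over $R$ are isomorphic as graded $R$-algebras. Here, for a matroid $M$ with ground set $E$, $A(M)$ is the quotient of the free exterior $R$-algebra on generators $e_x$, $x\in E$, in degree one, by the ideal generated by the elements $\partial(e_{x_1}\cdots e_{x_k})=\sum_{j=1}^k(-1)^{j-1}e_{x_1}\cdots\widehat{e_{x_j}}\cdots e_{x_k}$ for all circuits $\{x_1,\dots,x_k\}$ of $M$. 4. The Tutte polynomials differ: $T_{M_n}(x,y)\neq T_{M'_n}(x,y)$. -/

import Mathlib

open Set

noncomputable section

namespace Matroid

universe u v w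

/-! ### Simple and connected matroids -/

/-- A matroid is simple if it has no loops and no multiple points (parallel pairs). -/
structure IsSimple {α : Type u} (M : Matroid α) : Prop where
  not_isLoop : ∀ e, ¬ M.IsLoop e
  not_parallel : ∀ e f, e ≠ f → ¬ M.IsCircuit {e, f}

/-- A matroid is connected if any two distinct points lie on a common circuit. -/
def IsConnected {α : Type u} (M : Matroid α) : Prop :=
  ∀ e ∈ M.E, ∀ f ∈ M.E, e ≠ f → ∃ C, M.IsCircuit C ∧ e ∈ C ∧ f ∈ C

theorem IsSimple.isNonloop {α : Type u} {M : Matroid α} (h : M.IsSimple) {e : α} (he : e ∈ M.E) :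
    M.IsNonloop e :=
  ⟨h.not_isLoop e, he⟩

/-! ### The polygon matroid of a cycle, the isthmus, direct sums -/

/-- The polygon matroid `C_n` of the `n`-cycle: the points are the edges `0, …, n - 1` of the
cycle, and a set of edges is independent iff it has at most `n - 1` elements. -/
def polygon (n : ℕ) : Matroid (Fin n) :=
  (IndepMatroid.ofFinite (E := univ) finite_univ (fun I ↦ I.ncard ≤ n - 1)
    (by simp)
    (fun _ J hJ hIJ ↦ (ncard_le_ncard hIJ (toFinite J)).trans hJ)
    (fun I J _ hJ hlt ↦ by
      obtain ⟨e, heJ, heI⟩ := exists_mem_notMem_of_ncard_lt_ncard hlt (toFinite I)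
      refine ⟨e, heJ, heI, ?_⟩
      rw [ncard_insert_of_notMem heI (toFinite I)]
      omega)
    (fun _ _ ↦ subset_univ _)).matroid

theorem polygon_indep_iff {n : ℕ} {I : Set (Fin n)} : (polygon n).Indep I ↔ I.ncard ≤ n - 1 :=
  Iff.rfl

@[simp] theorem polygon_ground (n : ℕ) : (polygon n).E = univ := rfl

/-- The only circuit of `C_n` is the full set of `n` points. -/
theorem polygon_isCircuit_iff {n : ℕ} (hn : 1 ≤ n) {C : Set (Fin n)} :
    (polygon n).IsCircuit C ↔ C = univ := by
  have hlt : ∀ I : Set (Fin n), I ≠ univ → (polygon n).Indep I := fun I hI ↦ by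
    have h := ncard_lt_ncard (ssubset_univ_iff.2 hI) finite_univ
    rw [ncard_univ, Nat.card_fin] at h
    rw [polygon_indep_iff]
    omega
  have hdep : ¬ (polygon n).Indep (univ : Set (Fin n)) := by
    rw [polygon_indep_iff, ncard_univ, Nat.card_fin]
    omega
  refine ⟨fun h ↦ by_contra fun hne ↦ h.not_indep (hlt C hne), ?_⟩
  rintro rfl
  rw [isCircuit_iff_forall_ssubset]
  exact ⟨⟨hdep, subset_univ _⟩, fun I hI ↦ hlt I hI.ne⟩

theorem polygon_isNonloop {n : ℕ} (hn : 2 ≤ n) (i : Fin n) : (polygon n).IsNonloop i := by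
  rw [← indep_singleton, polygon_indep_iff, ncard_singleton]
  omega

instance polygon_finite (n : ℕ) : (polygon n).Finite := ⟨finite_univ⟩

/-- The isthmus `S`: the matroid of rank one on a single point. -/
def isthmus : Matroid Unit := freeOn univ

instance isthmus_finite : isthmus.Finite := ⟨toFinite _⟩

instance sum_finite {α : Type u} {β : Type v} (M : Matroid α) (N : Matroid β) [M.Finite]
    [N.Finite] : (M.sum N).Finite :=
  ⟨by rw [sum_ground]; exact (M.ground_finite.image _).union (N.ground_finite.image _)⟩

/-! ### Parallel connection -/

section ParallelConnection

variable {α : Type u} {β : Type v}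

/-- The disjoint union of `α` and `β`, with the point `p` of `α` identified with the point `q` of
`β`, is the type `{x : α // x ≠ p} ⊕ β`. This is the natural map from `α` to it; the natural map
from `β` to it is `Sum.inr`. -/
def glue (p : α) (q : β) (x : α) : {x : α // x ≠ p} ⊕ β :=
  open Classical in if h : x = p then Sum.inr q else Sum.inl ⟨x, h⟩

theorem glue_self (p : α) (q : β) : glue p q p = Sum.inr q := by simp [glue]

theorem glue_of_ne {p : α} (q : β) {x : α} (h : x ≠ p) : glue p q x = Sum.inl ⟨x, h⟩ := by
  simp [glue, h]

theorem glue_injective (p : α) (q : β) : Function.Injective (glue p q) := by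
  intro x y h
  by_cases hx : x = p <;> by_cases hy : y = p <;> simp_all [glue]

/-- The ground set of the parallel connection. -/
def parallelGround (M : Matroid α) (N : Matroid β) (p : α) (q : β) :
    Set ({x : α // x ≠ p} ⊕ β) :=
  glue p q '' M.E ∪ Sum.inr '' N.E

/-- The circuits of the parallel connection of `M` and `N` along `p` and `q`: the circuits of `M`,
the circuits of `N`, and the sets `(C \ {p}) ∪ (C' \ {q})` for circuits `C ∋ p` of `M` and
`C' ∋ q` of `N`. -/
def parallelCircuits (M : Matroid α) (N : Matroid β) (p : α) (q : β) :
    Set (Set ({x : α // x ≠ p} ⊕ β)) :=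
  {X | ∃ C, M.IsCircuit C ∧ X = glue p q '' C} ∪
  {X | ∃ C', N.IsCircuit C' ∧ X = Sum.inr '' C'} ∪
  {X | ∃ C C', M.IsCircuit C ∧ p ∈ C ∧ N.IsCircuit C' ∧ q ∈ C' ∧
    X = glue p q '' (C \ {p}) ∪ Sum.inr '' (C' \ {q})}

/-- A set of points is independent in the parallel connection if it contains no circuit. -/
def ParallelIndep (M : Matroid α) (N : Matroid β) (p : α) (q : β)
    (I : Set ({x : α // x ≠ p} ⊕ β)) : Prop :=
  I ⊆ parallelGround M N p q ∧ ∀ C ∈ parallelCircuits M N p q, ¬ C ⊆ I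

theorem inl_mem_parallelGround {M : Matroid α} {N : Matroid β} {p : α} {q : β}
    {x : {x : α // x ≠ p}} : Sum.inl x ∈ parallelGround M N p q ↔ x.1 ∈ M.E := by
  constructor
  · rintro (⟨y, hy, hyx⟩ | ⟨y, -, hyx⟩)
    · by_cases h : y = p
      · subst h; simp [glue_self] at hyx
      · rw [glue_of_ne q h, Sum.inl.injEq] at hyx
        rwa [← hyx]
    · cases hyx
  · exact fun h ↦ Or.inl ⟨x.1, h, glue_of_ne q x.2⟩

theorem inr_mem_parallelGround {M : Matroid α} {N : Matroid β} {p : α} {q : β} (hq : q ∈ N.E)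
    {y : β} : Sum.inr y ∈ parallelGround M N p q ↔ y ∈ N.E := by
  constructor
  · rintro (⟨x, hx, hxy⟩ | ⟨x, hx, hxy⟩)
    · by_cases h : x = p
      · subst h
        rw [glue_self, Sum.inr.injEq] at hxy
        rwa [← hxy]
      · rw [glue_of_ne q h] at hxy; cases hxy
    · cases hxy; exact hx
  · exact fun h ↦ Or.inr ⟨y, h, rfl⟩

/-- The independent sets of the parallel connection in terms of `M` and `N`. -/
theorem parallelIndep_iff {M : Matroid α} {N : Matroid β} {p : α} {q : β}
    (hp : M.IsNonloop p) (hq : N.IsNonloop q) {I : Set ({x : α // x ≠ p} ⊕ β)} :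
    ParallelIndep M N p q I ↔ M.Indep (Subtype.val '' (Sum.inl ⁻¹' I)) ∧
      N.Indep (Sum.inr ⁻¹' I) ∧
      ¬ (p ∈ M.closure (Subtype.val '' (Sum.inl ⁻¹' I)) ∧ q ∈ N.closure (Sum.inr ⁻¹' I)) := by
  set A : Set α := Subtype.val '' (Sum.inl ⁻¹' I) with hA
  set B : Set β := Sum.inr ⁻¹' I with hB
  have hpA : p ∉ A := by rintro ⟨x, -, hx⟩; exact x.2 hx
  have hAI : ∀ X : Set α, X ⊆ A → glue p q '' X ⊆ I := by
    rintro X hX _ ⟨x, hx, rfl⟩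
    obtain ⟨y, hy, rfl⟩ := hX hx
    rwa [glue_of_ne q y.2]
  have hIA : ∀ X : Set α, glue p q '' X ⊆ I → X \ {p} ⊆ A := by
    intro X hX x hx
    have := hX (mem_image_of_mem _ hx.1)
    rw [glue_of_ne q hx.2] at this
    exact ⟨⟨x, hx.2⟩, this, rfl⟩
  have hspan : ∀ C, M.IsCircuit C → p ∈ C → C \ {p} ⊆ A → p ∈ M.closure A := fun C hC hpC h ↦
    M.closure_subset_closure h (hC.mem_closure_sdiff_singleton_of_mem hpC)
  constructor
  · rintro ⟨hE, hI⟩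
    have hAi : M.Indep A := by
      rw [indep_iff_forall_subset_not_isCircuit']
      refine ⟨fun C hCA hC ↦ hI _ (Or.inl (Or.inl ⟨C, hC, rfl⟩)) (hAI C hCA), ?_⟩
      rintro _ ⟨x, hx, rfl⟩
      exact inl_mem_parallelGround.1 (hE hx)
    have hBi : N.Indep B := by
      rw [indep_iff_forall_subset_not_isCircuit']
      refine ⟨fun C hCB hC ↦ hI _ (Or.inl (Or.inr ⟨C, hC, rfl⟩)) (image_subset_iff.2 hCB), ?_⟩
      exact fun x hx ↦ (inr_mem_parallelGround hq.mem_ground).1 (hE hx)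
    refine ⟨hAi, hBi, ?_⟩
    rintro ⟨h1, h2⟩
    obtain ⟨C, hCA, hC, hpC⟩ := exists_isCircuit_of_mem_closure h1 hpA
    have hCA' : C \ {p} ⊆ A := by simpa using hCA
    by_cases hqB : q ∈ B
    · refine hI _ (Or.inl (Or.inl ⟨C, hC, rfl⟩)) ?_
      rintro _ ⟨x, hx, rfl⟩
      by_cases hxp : x = p
      · subst hxp; rw [glue_self]; exact hqB
      · exact hAI _ hCA' (mem_image_of_mem _ ⟨hx, hxp⟩)
    · obtain ⟨C', hCB, hC', hqC⟩ := exists_isCircuit_of_mem_closure h2 hqB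
      refine hI _ (Or.inr ⟨C, C', hC, hpC, hC', hqC, rfl⟩) (union_subset (hAI _ hCA') ?_)
      rw [image_subset_iff]
      simpa using hCB
  · rintro ⟨hAi, hBi, hAB⟩
    refine ⟨?_, ?_⟩
    · rintro (x | y) hx
      · exact inl_mem_parallelGround.2 (hAi.subset_ground ⟨x, hx, rfl⟩)
      · exact (inr_mem_parallelGround hq.mem_ground).2 (hBi.subset_ground hx)
    · rintro _ ((⟨C, hC, rfl⟩ | ⟨C', hC', rfl⟩) | ⟨C, C', hC, hpC, hC', hqC, rfl⟩) h
      · have hCA := hIA C h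
        by_cases hpC : p ∈ C
        · refine hAB ⟨hspan C hC hpC hCA, N.mem_closure_of_mem ?_ hBi.subset_ground⟩
          have := h (mem_image_of_mem _ hpC)
          rwa [glue_self] at this
        · rw [sdiff_singleton_eq_self hpC] at hCA
          exact hC.not_indep (hAi.subset hCA)
      · exact hC'.not_indep (hBi.subset (image_subset_iff.1 h))
      · obtain ⟨h1, h2⟩ := union_subset_iff.1 h
        have hCA := hIA _ h1
        rw [sdiff_sdiff, union_self] at hCA
        exact hAB ⟨hspan C hC hpC hCA, N.closure_subset_closure (image_subset_iff.1 h2)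
          (hC'.mem_closure_sdiff_singleton_of_mem hqC)⟩

theorem parallel_augment_aux {M : Matroid α} {N : Matroid β} [M.Finite] [N.Finite] {p : α} {q : β}
    (hp : p ∈ M.E) (hq : q ∈ N.E) {A A' : Set α} {B B' : Set β} (hA : M.Indep A)
    (hA' : M.Indep A') (hB : N.Indep B) (hB' : N.Indep B')
    (hI : p ∉ M.closure A) (hJ : ¬ (p ∈ M.closure A' ∧ q ∈ N.closure B'))
    (hlt : A.encard + B.encard < A'.encard + B'.encard) :
    (∃ e ∈ A', e ∉ A ∧ M.Indep (insert e A) ∧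
      ¬ (p ∈ M.closure (insert e A) ∧ q ∈ N.closure B)) ∨
    (∃ e ∈ B', e ∉ B ∧ N.Indep (insert e B) ∧
      ¬ (p ∈ M.closure A ∧ q ∈ N.closure (insert e B))) := by
  by_contra hcon
  push Not at hcon
  obtain ⟨h1, h2⟩ := hcon
  have hB'B : B' ⊆ N.closure B := by
    intro e he
    by_contra hecl
    have heB : e ∉ B := fun h ↦ hecl (N.mem_closure_of_mem h hB.subset_ground)
    exact hI (h2 e he heB ((hB.insert_indep_iff_of_notMem heB).2
      ⟨hB'.subset_ground he, hecl⟩)).1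
  have hBle : B'.encard ≤ B.encard := by
    rw [← hB.eRk_eq_encard, ← hB'.eRk_eq_encard, ← N.eRk_closure_eq B]
    exact N.eRk_mono hB'B
  have hBfin := N.ground_finite.subset hB.subset_ground
  have hB'fin := N.ground_finite.subset hB'.subset_ground
  have hAfin := M.ground_finite.subset hA.subset_ground
  have hA'fin := M.ground_finite.subset hA'.subset_ground
  have hAlt : A.encard < A'.encard := by
    by_contra hle
    exact absurd (add_le_add (not_lt.1 hle) hBle) (not_le.2 hlt)
  obtain ⟨e₁, he₁, hi₁⟩ := hA.exists_insert_of_encard_lt hA' hAlt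
  have hqB : q ∈ N.closure B := (h1 e₁ he₁.1 he₁.2 hi₁).2
  have hA'A : A' ⊆ M.closure (insert p A) := by
    intro e he
    by_cases hecl : e ∈ M.closure A
    · exact M.closure_subset_closure (subset_insert _ _) hecl
    · have heA : e ∉ A := fun h ↦ hecl (M.mem_closure_of_mem h hA.subset_ground)
      exact mem_closure_insert hI (h1 e he heA ((hA.insert_indep_iff_of_notMem heA).2
        ⟨hA'.subset_ground he, hecl⟩)).1
  have hpcl : p ∈ M.closure (insert p A) :=
    M.mem_closure_of_mem (mem_insert _ _) (insert_subset hp hA.subset_ground)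
  have hr : M.eRk (insert p A) ≤ A.encard + 1 := by
    rw [← hA.eRk_eq_encard]; exact M.eRk_insert_le_add_one p A
  have hpA' : p ∈ M.closure A' := by
    by_contra hpA'
    have h3 : M.eRk (insert p A') ≤ M.eRk (insert p A) := by
      rw [← M.eRk_closure_eq (insert p A)]
      exact M.eRk_mono (insert_subset hpcl hA'A)
    rw [eRk_insert_eq_add_one ⟨hp, hpA'⟩, hA'.eRk_eq_encard] at h3
    have h4 := (ENat.add_le_add_iff_right (by simp)).1 (h3.trans hr)
    exact absurd h4 (not_le.2 hAlt)
  have hqB' : q ∉ N.closure B' := fun h ↦ hJ ⟨hpA', h⟩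
  have hA'le : A'.encard ≤ A.encard + 1 := by
    rw [← hA'.eRk_eq_encard]
    refine le_trans ?_ hr
    rw [← M.eRk_closure_eq (insert p A)]
    exact M.eRk_mono hA'A
  have hB'le : B'.encard + 1 ≤ B.encard := by
    rw [← hB'.eRk_eq_encard, ← eRk_insert_eq_add_one ⟨hq, hqB'⟩, ← hB.eRk_eq_encard,
      ← N.eRk_closure_eq B]
    exact N.eRk_mono (insert_subset hqB hB'B)
  rw [← hAfin.cast_ncard_eq, ← hA'fin.cast_ncard_eq] at *
  rw [← hBfin.cast_ncard_eq, ← hB'fin.cast_ncard_eq] at *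
  norm_cast at *
  omega

theorem parallel_encard {p : α} (I : Set ({x : α // x ≠ p} ⊕ β)) :
    I.encard = (Subtype.val '' (Sum.inl ⁻¹' I) : Set α).encard + (Sum.inr ⁻¹' I).encard := by
  conv_lhs => rw [← image_preimage_inl_union_image_preimage_inr I]
  rw [encard_union_eq, Sum.inl_injective.encard_image, Sum.inr_injective.encard_image,
    Subtype.val_injective.encard_image]
  rw [Set.disjoint_left]
  rintro _ ⟨x, -, rfl⟩ ⟨y, -, h⟩
  cases h

theorem parallelIndep_augment {M : Matroid α} {N : Matroid β} [M.Finite] [N.Finite] {p : α} {q : β}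
    (hp : M.IsNonloop p) (hq : N.IsNonloop q) {I J : Set ({x : α // x ≠ p} ⊕ β)}
    (hI : ParallelIndep M N p q I) (hJ : ParallelIndep M N p q J) (hlt : I.encard < J.encard) :
    ∃ e ∈ J, e ∉ I ∧ ParallelIndep M N p q (insert e I) := by
  rw [parallel_encard, parallel_encard] at hlt
  rw [parallelIndep_iff hp hq] at hI hJ
  obtain ⟨hA, hB, hAB⟩ := hI
  obtain ⟨hA', hB', hAB'⟩ := hJ
  have key : (∃ e ∈ (Subtype.val '' (Sum.inl ⁻¹' J) : Set α), e ∉ Subtype.val '' (Sum.inl ⁻¹' I) ∧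
      M.Indep (insert e (Subtype.val '' (Sum.inl ⁻¹' I))) ∧
      ¬ (p ∈ M.closure (insert e (Subtype.val '' (Sum.inl ⁻¹' I))) ∧
        q ∈ N.closure (Sum.inr ⁻¹' I))) ∨
      (∃ e ∈ Sum.inr ⁻¹' J, e ∉ Sum.inr ⁻¹' I ∧ N.Indep (insert e (Sum.inr ⁻¹' I)) ∧
      ¬ (p ∈ M.closure (Subtype.val '' (Sum.inl ⁻¹' I)) ∧
        q ∈ N.closure (insert e (Sum.inr ⁻¹' I)))) := by
    by_cases h : p ∈ M.closure (Subtype.val '' (Sum.inl ⁻¹' I))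
    · have h' : q ∉ N.closure (Sum.inr ⁻¹' I) := fun h' ↦ hAB ⟨h, h'⟩
      rw [add_comm (encard (Subtype.val '' (Sum.inl ⁻¹' I))),
        add_comm (encard (Subtype.val '' (Sum.inl ⁻¹' J)))] at hlt
      rw [and_comm] at hAB'
      have := parallel_augment_aux hq.mem_ground hp.mem_ground hB hB' hA hA' h' hAB' hlt
      rw [or_comm] at this
      simpa only [and_comm (a := q ∈ _)] using this
    · exact parallel_augment_aux hp.mem_ground hq.mem_ground hA hA' hB hB' h hAB' hlt
  obtain (⟨_, ⟨e, he, rfl⟩, heI, h1, h2⟩ | ⟨e, he, heI, h1, h2⟩) := key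
  · refine ⟨Sum.inl e, he, fun h ↦ heI ⟨e, h, rfl⟩, ?_⟩
    have e1 : (Subtype.val '' (Sum.inl ⁻¹' (insert (Sum.inl e) I)) : Set α) =
        insert e.1 (Subtype.val '' (Sum.inl ⁻¹' I)) := by
      rw [← image_insert_eq]
      congr 1
      ext x
      simp
    have e2 : (Sum.inr ⁻¹' (insert (Sum.inl e) I) : Set β) = Sum.inr ⁻¹' I := by
      ext x
      simp
    rw [parallelIndep_iff hp hq, e1, e2]
    exact ⟨h1, hB, h2⟩
  · refine ⟨Sum.inr e, he, heI, ?_⟩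
    have e1 : (Subtype.val '' (Sum.inl ⁻¹' (insert (Sum.inr e) I)) : Set α) =
        Subtype.val '' (Sum.inl ⁻¹' I) := by
      congr 1
      ext x
      simp
    have e2 : (Sum.inr ⁻¹' (insert (Sum.inr e) I) : Set β) = insert e (Sum.inr ⁻¹' I) := by
      ext x
      simp
    rw [parallelIndep_iff hp hq, e1, e2]
    exact ⟨hA, h1, h2⟩

/-- The parallel connection `P(M, N)` of two finite matroids, with the point `p` of `M` identified
with the point `q` of `N`. -/
def parallelConnection (M : Matroid α) (N : Matroid β) [M.Finite] [N.Finite] (p : α) (q : β)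
    (hp : M.IsNonloop p) (hq : N.IsNonloop q) : Matroid ({x : α // x ≠ p} ⊕ β) :=
  (IndepMatroid.ofFinite (E := parallelGround M N p q)
    ((M.ground_finite.image _).union (N.ground_finite.image _))
    (ParallelIndep M N p q)
    ((parallelIndep_iff hp hq).2 ⟨by simp, by simp, fun h ↦ hp.not_isLoop (by
      have h1 := h.1
      rwa [preimage_empty, image_empty] at h1)⟩)
    (fun _ _ hJ hIJ ↦ ⟨hIJ.trans hJ.1, fun C hC hCI ↦ hJ.2 C hC (hCI.trans hIJ)⟩)
    (fun I J hI hJ hlt ↦ parallelIndep_augment hp hq hI hJ (by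
      have hfin : (parallelGround M N p q).Finite :=
        (M.ground_finite.image _).union (N.ground_finite.image _)
      rw [← (hfin.subset hI.1).cast_ncard_eq, ← (hfin.subset hJ.1).cast_ncard_eq]
      exact_mod_cast hlt))
    (fun _ h ↦ h.1)).matroid

theorem parallelConnection_ground (M : Matroid α) (N : Matroid β) [M.Finite] [N.Finite] (p : α)
    (q : β) (hp : M.IsNonloop p) (hq : N.IsNonloop q) :
    (parallelConnection M N p q hp hq).E = glue p q '' M.E ∪ Sum.inr '' N.E := rfl

theorem parallelConnection_indep_iff (M : Matroid α) (N : Matroid β) [M.Finite] [N.Finite] (p : α)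
    (q : β) (hp : M.IsNonloop p) (hq : N.IsNonloop q) {I : Set ({x : α // x ≠ p} ⊕ β)} :
    (parallelConnection M N p q hp hq).Indep I ↔ ParallelIndep M N p q I := Iff.rfl

instance parallelConnection_finite (M : Matroid α) (N : Matroid β) [M.Finite] [N.Finite] (p : α)
    (q : β) (hp : M.IsNonloop p) (hq : N.IsNonloop q) :
    (parallelConnection M N p q hp hq).Finite :=
  ⟨(M.ground_finite.image _).union (N.ground_finite.image _)⟩

theorem parallelCircuits_subset_ground {M : Matroid α} {N : Matroid β} {p : α} {q : β}
    {X : Set ({x : α // x ≠ p} ⊕ β)} (hX : X ∈ parallelCircuits M N p q) :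
    X ⊆ parallelGround M N p q := by
  obtain ((⟨C, hC, rfl⟩ | ⟨C', hC', rfl⟩) | ⟨C, C', hC, hpC, hC', hqC, rfl⟩) := hX
  · exact (image_mono hC.subset_ground).trans subset_union_left
  · exact (image_mono hC'.subset_ground).trans subset_union_right
  · exact union_subset_union (image_mono (sdiff_subset.trans hC.subset_ground))
      (image_mono (sdiff_subset.trans hC'.subset_ground))

theorem nontrivial_of_isNonloop {M : Matroid α} {p : α} (hp : M.IsNonloop p) {C : Set α}
    (hC : M.IsCircuit C) : ∃ x ∈ C, x ≠ p := by
  by_contra! h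
  exact hC.not_indep ((indep_singleton.2 hp).subset h)

theorem parallelCircuits_antichain {M : Matroid α} {N : Matroid β} {p : α} {q : β}
    (hp : M.IsNonloop p) (hq : N.IsNonloop q) {X Y : Set ({x : α // x ≠ p} ⊕ β)}
    (hX : X ∈ parallelCircuits M N p q) (hY : Y ∈ parallelCircuits M N p q) (h : X ⊆ Y) :
    X = Y := by
  have hgl : ∀ {S : Set α} {x : {x : α // x ≠ p}}, Sum.inl x ∈ glue p q '' S ↔ x.1 ∈ S := by
    intro S x
    rw [← glue_of_ne q x.2, (glue_injective p q).mem_set_image]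
  have hgr : ∀ {S : Set α} {y : β}, Sum.inr y ∈ glue p q '' S ↔ y = q ∧ p ∈ S := by
    intro S y
    constructor
    · rintro ⟨x, hx, hxy⟩
      by_cases h : x = p
      · subst h
        rw [glue_self, Sum.inr.injEq] at hxy
        exact ⟨hxy.symm, hx⟩
      · rw [glue_of_ne q h] at hxy; cases hxy
    · rintro ⟨rfl, h⟩
      exact ⟨p, h, glue_self p _⟩
  have hnl : ∀ {S : Set β} {x : {x : α // x ≠ p}},
      (Sum.inl x : {x : α // x ≠ p} ⊕ β) ∈ (Sum.inr '' S : Set ({x : α // x ≠ p} ⊕ β)) ↔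
        False := by
    simp
  have hnr : ∀ {S : Set β} {y : β},
      (Sum.inr y : {x : α // x ≠ p} ⊕ β) ∈ (Sum.inr '' S : Set ({x : α // x ≠ p} ⊕ β)) ↔
        y ∈ S := by
    simp
  obtain ((⟨C, hC, rfl⟩ | ⟨C', hC', rfl⟩) | ⟨C, C', hC, hpC, hC', hqC, rfl⟩) := hX <;>
  obtain ((⟨D, hD, rfl⟩ | ⟨D', hD', rfl⟩) | ⟨D, D', hD, hpD, hD', hqD, rfl⟩) := hY
  · rw [hC.eq_of_subset_isCircuit hD ((image_subset_image_iff (glue_injective p q)).1 h)]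
  · obtain ⟨x, hx, hxp⟩ := nontrivial_of_isNonloop hp hC
    exact (hnl.1 (h (hgl (x := ⟨x, hxp⟩).2 hx))).elim
  · have hCD : C ⊆ D \ {p} := by
      intro x hx
      by_cases hxp : x = p
      · subst hxp
        obtain (h1 | h1) := h (mem_image_of_mem _ hx)
        · exact (glue_injective _ q).mem_set_image.1 h1
        · rw [glue_self, hnr] at h1; exact absurd rfl h1.2
      · obtain (h1 | h1) := h (mem_image_of_mem _ hx)
        · exact (glue_injective _ q).mem_set_image.1 h1
        · rw [glue_of_ne q hxp, hnl] at h1; exact h1.elim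
    have := hC.eq_of_subset_isCircuit hD (hCD.trans sdiff_subset)
    subst this
    exact absurd rfl (hCD hpD).2
  · obtain ⟨y, hy, hyq⟩ := nontrivial_of_isNonloop hq hC'
    exact absurd (hgr.1 (h (hnr.2 hy))).1 hyq
  · rw [hC'.eq_of_subset_isCircuit hD' ((image_subset_image_iff Sum.inr_injective).1 h)]
  · have hCD : C' ⊆ D' \ {q} := by
      intro y hy
      obtain (h1 | h1) := h (mem_image_of_mem _ hy)
      · exact absurd rfl (hgr.1 h1).2.2
      · exact hnr.1 h1
    have := hC'.eq_of_subset_isCircuit hD' (hCD.trans sdiff_subset)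
    subst this
    exact absurd rfl (hCD hqD).2
  · obtain ⟨y, hy, hyq⟩ := nontrivial_of_isNonloop hq hC'
    exact absurd (hgr.1 (h (Or.inr (hnr.2 ⟨hy, hyq⟩)))).1 hyq
  · obtain ⟨x, hx, hxp⟩ := nontrivial_of_isNonloop hp hC
    exact (hnl.1 (h (Or.inl (hgl (x := ⟨x, hxp⟩).2 ⟨hx, hxp⟩)))).elim
  · have hCD : C ⊆ D := by
      intro x hx
      by_cases hxp : x = p
      · rwa [hxp]
      · obtain (h1 | h1) := h (Or.inl (hgl (x := ⟨x, hxp⟩).2 ⟨hx, hxp⟩))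
        · exact (hgl.1 h1).1
        · exact (hnl.1 h1).elim
    have hCD' : C' ⊆ D' := by
      intro y hy
      by_cases hyq : y = q
      · rwa [hyq]
      · obtain (h1 | h1) := h (Or.inr (hnr.2 ⟨hy, hyq⟩))
        · exact absurd (hgr.1 h1).1 hyq
        · exact (hnr.1 h1).1
    rw [hC.eq_of_subset_isCircuit hD hCD, hC'.eq_of_subset_isCircuit hD' hCD']

/-- The circuits of the parallel connection are the members of `parallelCircuits`. -/
theorem parallelConnection_isCircuit_iff (M : Matroid α) (N : Matroid β) [M.Finite] [N.Finite]
    (p : α) (q : β) (hp : M.IsNonloop p) (hq : N.IsNonloop q)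
    {X : Set ({x : α // x ≠ p} ⊕ β)} :
    (parallelConnection M N p q hp hq).IsCircuit X ↔ X ∈ parallelCircuits M N p q := by
  have hdep : ∀ {Y}, (parallelConnection M N p q hp hq).Dep Y →
      ∃ C ∈ parallelCircuits M N p q, C ⊆ Y := by
    intro Y hY
    by_contra! hcon
    exact hY.not_indep ((parallelConnection_indep_iff M N p q hp hq).2 ⟨hY.subset_ground, hcon⟩)
  have hcirc : ∀ {C}, C ∈ parallelCircuits M N p q →
      (parallelConnection M N p q hp hq).Dep C := fun {C} hC ↦
    ⟨fun h ↦ ((parallelConnection_indep_iff M N p q hp hq).1 h).2 C hC subset_rfl,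
      parallelCircuits_subset_ground hC⟩
  rw [isCircuit_iff]
  constructor
  · rintro ⟨hX, hmin⟩
    obtain ⟨C, hC, hCX⟩ := hdep hX
    rwa [← hmin (hcirc hC) hCX]
  · refine fun hX ↦ ⟨hcirc hX, fun D hD hDX ↦ ?_⟩
    obtain ⟨C, hC, hCD⟩ := hdep hD
    have := parallelCircuits_antichain hp hq hC hX (hCD.trans hDX)
    subst this
    exact hDX.antisymm hCD

end ParallelConnection

/-! ### The Tutte polynomial -/

/-- The rank of a set of points, as a natural number. -/
def rank {α : Type u} (M : Matroid α) (A : Set α) : ℕ := (M.eRk A).toNat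

/-- The Tutte polynomial `T_M(x, y) = ∑ (x - 1) ^ (r(E) - r(A)) * (y - 1) ^ (|A| - r(A))`, the sum
over all subsets `A` of the ground set `E`; here `x = X 0` and `y = X 1`. The recursive rules for
loops, isthmuses and for deletion and contraction, which also determine it, are proved below. -/
def tutte {α : Type u} (M : Matroid α) [M.Finite] : MvPolynomial (Fin 2) ℤ :=
  ∑ A ∈ M.ground_finite.toFinset.powerset,
    (MvPolynomial.X 0 - 1) ^ (M.rank M.E - M.rank (A : Set α)) *
      (MvPolynomial.X 1 - 1) ^ (A.card - M.rank (A : Set α))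

section Tutte

variable {α : Type u} (M : Matroid α)

theorem cast_rank [M.Finite] (A : Set α) : (M.rank A : ℕ∞) = M.eRk A :=
  ENat.natCast_toNat (eRk_ne_top_iff.2 (M.isRkFinite_set A))

theorem tutte_of_ground_eq_empty [M.Finite] (h : M.E = ∅) : M.tutte = 1 := by
  simp [tutte, h]

theorem tutte_split [M.Finite] {e : α} (he : e ∈ M.E) (D : Finset α) (hD : (D : Set α) = M.E \ {e}) :
    M.tutte = ∑ A ∈ D.powerset,
      ((MvPolynomial.X 0 - 1) ^ (M.rank M.E - M.rank (A : Set α)) *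
        (MvPolynomial.X 1 - 1) ^ (A.card - M.rank (A : Set α)) +
      (MvPolynomial.X 0 - 1) ^ (M.rank M.E - M.rank (insert e (A : Set α))) *
        (MvPolynomial.X 1 - 1) ^ (A.card + 1 - M.rank (insert e (A : Set α)))) := by
  classical
  have heD : e ∉ D := fun h ↦ by
    have : e ∈ (D : Set α) := h
    rw [hD] at this
    exact this.2 rfl
  have hE : M.ground_finite.toFinset = insert e D := by
    rw [← Finset.coe_inj, Finite.coe_toFinset, Finset.coe_insert, hD, insert_sdiff_singleton,
      insert_eq_of_mem he]
  rw [tutte, hE, Finset.sum_powerset_insert heD, ← Finset.sum_add_distrib]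
  refine Finset.sum_congr rfl fun A hA ↦ ?_
  rw [Finset.card_insert_of_notMem fun h ↦ heD (Finset.mem_powerset.1 hA h), Finset.coe_insert]

theorem rank_delete {e : α} {A : Set α} (hA : A ⊆ M.E \ {e}) :
    (M.delete {e}).rank A = M.rank A := by
  rw [rank, rank, delete, restrict_eRk_eq _ hA]

theorem tutte_delete [M.Finite] (e : α) (D : Finset α) (hD : (D : Set α) = M.E \ {e}) :
    (M.delete {e}).tutte = ∑ A ∈ D.powerset,
      (MvPolynomial.X 0 - 1) ^ (M.rank (M.E \ {e}) - M.rank (A : Set α)) *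
        (MvPolynomial.X 1 - 1) ^ (A.card - M.rank (A : Set α)) := by
  have hE : (M.delete {e}).ground_finite.toFinset = D := by
    rw [← Finset.coe_inj, Finite.coe_toFinset, hD, delete_ground]
  rw [tutte, hE]
  refine Finset.sum_congr rfl fun A hA ↦ ?_
  have hAD : (A : Set α) ⊆ M.E \ {e} := by
    rw [← hD]; exact_mod_cast Finset.mem_powerset.1 hA
  rw [rank_delete M hAD, delete_ground, rank_delete M subset_rfl]

/-- A loop contributes a factor `y`. -/
theorem tutte_of_isLoop [M.Finite] {e : α} (he : M.IsLoop e) :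
    M.tutte = MvPolynomial.X 1 * (M.delete {e}).tutte := by
  have hfin : (M.E \ {e}).Finite := M.ground_finite.subset sdiff_subset
  have hD : ((hfin.toFinset : Finset α) : Set α) = M.E \ {e} := hfin.coe_toFinset
  have hins : ∀ A : Set α, M.rank (insert e A) = M.rank A := fun A ↦ by
    rw [rank, rank, ← eRk_closure_eq, closure_insert_eq_of_mem_closure
      (M.closure_subset_closure (empty_subset A) he), eRk_closure_eq]
  have hr : M.rank (M.E \ {e}) = M.rank M.E := by
    rw [← hins, insert_sdiff_singleton, insert_eq_of_mem he.mem_ground]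
  rw [tutte_split M he.mem_ground _ hD, tutte_delete M e _ hD, Finset.mul_sum]
  refine Finset.sum_congr rfl fun A _ ↦ ?_
  have hle : M.rank (A : Set α) ≤ A.card := by
    have := M.eRk_le_encard (A : Set α)
    rw [← cast_rank, encard_coe_eq_coe_finsetCard] at this
    exact_mod_cast this
  rw [hins, hr, Nat.sub_add_comm hle]
  ring

theorem rank_insert_of_isColoop [M.Finite] {e : α} (he : M.IsColoop e) {A : Set α}
    (hA : A ⊆ M.E \ {e}) : M.rank (insert e A) = M.rank A + 1 := by
  have hcl : e ∉ M.closure A := fun h ↦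
    (isColoop_iff_notMem_closure_compl he.mem_ground).1 he (M.closure_subset_closure hA h)
  have := eRk_insert_eq_add_one ⟨he.mem_ground, hcl⟩
  rw [← cast_rank, ← cast_rank] at this
  exact_mod_cast this

theorem rank_mono [M.Finite] {A B : Set α} (h : A ⊆ B) : M.rank A ≤ M.rank B := by
  have := M.eRk_mono h
  rw [← cast_rank, ← cast_rank] at this
  exact_mod_cast this

/-- An isthmus contributes a factor `x`. -/
theorem tutte_of_isColoop [M.Finite] {e : α} (he : M.IsColoop e) :
    M.tutte = MvPolynomial.X 0 * (M.delete {e}).tutte := by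
  have hfin : (M.E \ {e}).Finite := M.ground_finite.subset sdiff_subset
  have hD : ((hfin.toFinset : Finset α) : Set α) = M.E \ {e} := hfin.coe_toFinset
  have hr : M.rank M.E = M.rank (M.E \ {e}) + 1 := by
    rw [← rank_insert_of_isColoop M he subset_rfl, insert_sdiff_singleton,
      insert_eq_of_mem he.mem_ground]
  rw [tutte_split M he.mem_ground _ hD, tutte_delete M e _ hD, Finset.mul_sum]
  refine Finset.sum_congr rfl fun A hA ↦ ?_
  have hAD : (A : Set α) ⊆ M.E \ {e} := by
    rw [← hD]; exact_mod_cast Finset.mem_powerset.1 hA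
  rw [rank_insert_of_isColoop M he hAD, hr, Nat.add_sub_add_right, Nat.add_sub_add_right,
    Nat.sub_add_comm (rank_mono M hAD)]
  ring

theorem rank_contract [M.Finite] {e : α} (he : M.IsNonloop e) {A : Set α} (hA : A ⊆ M.E \ {e}) :
    (M.contract {e}).rank A + 1 = M.rank (insert e A) := by
  have heA : e ∉ A := fun h ↦ (hA h).2 rfl
  obtain ⟨I, hI⟩ := (M.contract {e}).exists_isBasis A hA
  have hIe := (he.contractElem_indep_iff.1 hI.indep)
  have hb : M.IsBasis (insert e I) (insert e A) := by
    refine (hIe.2).isBasis_of_forall_insert (insert_subset_insert hI.subset) ?_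
    rintro x ⟨hx, hxI⟩
    have hxe : x ≠ e := by rintro rfl; exact hxI (mem_insert _ _)
    have hxA : x ∈ A := hx.resolve_left hxe
    have hxI' : x ∉ I := fun h ↦ hxI (mem_insert_of_mem _ h)
    refine ⟨fun hi ↦ ?_, insert_subset (hA hxA).1 hIe.2.subset_ground⟩
    refine (hI.insert_dep ⟨hxA, hxI'⟩).not_indep (he.contractElem_indep_iff.2 ⟨?_, ?_⟩)
    · rintro (h | h)
      · exact hxe h.symm
      · exact hIe.1 h
    · rwa [insert_comm]
  have h1 := hb.encard_eq_eRk
  have h2 := hI.encard_eq_eRk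
  rw [encard_insert_of_notMem hIe.1, h2, ← cast_rank, ← cast_rank] at h1
  exact_mod_cast h1

/-- Deletion and contraction of a point that is neither a loop nor an isthmus. -/
theorem tutte_eq_delete_add_contract [M.Finite] {e : α} (he : e ∈ M.E) (hl : ¬ M.IsLoop e)
    (hc : ¬ M.IsColoop e) : M.tutte = (M.delete {e}).tutte + (M.contract {e}).tutte := by
  have hfin : (M.E \ {e}).Finite := M.ground_finite.subset sdiff_subset
  have hD : ((hfin.toFinset : Finset α) : Set α) = M.E \ {e} := hfin.coe_toFinset
  have hr : M.rank (M.E \ {e}) = M.rank M.E := by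
    have hcl : e ∈ M.closure (M.E \ {e}) := by
      by_contra h
      exact hc ((isColoop_iff_notMem_closure_compl he).2 h)
    rw [rank, rank, ← eRk_closure_eq, ← closure_insert_eq_of_mem_closure hcl,
      insert_sdiff_singleton, insert_eq_of_mem he, eRk_closure_eq]
  have hE : (M.contract {e}).ground_finite.toFinset = hfin.toFinset := by
    rw [← Finset.coe_inj, Finite.coe_toFinset, hD, contract_ground]
  have hrE : (M.contract {e}).rank (M.E \ {e}) + 1 = M.rank M.E := by
    rw [rank_contract M ⟨hl, he⟩ subset_rfl, insert_sdiff_singleton, insert_eq_of_mem he]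
  rw [tutte_split M he _ hD, tutte_delete M e _ hD, Finset.sum_add_distrib, hr]
  congr 1
  rw [tutte, hE]
  refine Finset.sum_congr rfl fun A hA ↦ ?_
  have hAD : (A : Set α) ⊆ M.E \ {e} := by
    rw [← hD]; exact_mod_cast Finset.mem_powerset.1 hA
  rw [← rank_contract M ⟨hl, he⟩ hAD, contract_ground, ← hrE, Nat.add_sub_add_right,
    Nat.add_sub_add_right]

end Tutte

/-! ### The Orlik-Solomon algebra -/

section OrlikSolomon

variable (R : Type w) [CommRing R] {α : Type u} (M : Matroid α)

/-- The free exterior algebra on the ground set of `M`. -/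
abbrev OSExterior : Type _ := ExteriorAlgebra R (M.E →₀ R)

/-- The generator of the exterior algebra given by a point of `M`. -/
def osGen (e : M.E) : OSExterior R M := ExteriorAlgebra.ι R (Finsupp.single e 1)

/-- The linear map `∂` with `∂(e₁ ⋯ eₖ) = ∑ᵢ (-1)^(i-1) e₁ ⋯ êᵢ ⋯ eₖ`, realized as the contraction
with the linear form that takes the value `1` at each point. -/
def osBoundary : OSExterior R M →ₗ[R] OSExterior R M :=
  CliffordAlgebra.contractLeft (Finsupp.linearCombination R fun _ : M.E ↦ (1 : R))

theorem osBoundary_one : osBoundary R M 1 = 0 :=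
  CliffordAlgebra.contractLeft_one _ _

theorem osBoundary_osGen_mul (e : M.E) (x : OSExterior R M) :
    osBoundary R M (osGen R M e * x) = x - osGen R M e * osBoundary R M x := by
  have h := CliffordAlgebra.contractLeft_ι_mul (Q := (0 : QuadraticForm R (M.E →₀ R)))
    (d := Finsupp.linearCombination R fun _ : M.E ↦ (1 : R)) (Finsupp.single e 1) x
  rw [Finsupp.linearCombination_single, smul_eq_mul, mul_one, one_smul] at h
  exact h

/-- The explicit formula for `∂` on a product of generators. -/
theorem osBoundary_prod (l : List M.E) :
    osBoundary R M (l.map (osGen R M)).prod =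
      ∑ i ∈ Finset.range l.length, (-1) ^ i * ((l.eraseIdx i).map (osGen R M)).prod := by
  induction l with
  | nil => simpa using osBoundary_one R M
  | cons e l ih =>
    rw [List.map_cons, List.prod_cons, osBoundary_osGen_mul, ih, List.length_cons,
      Finset.sum_range_succ', Finset.mul_sum, sub_eq_neg_add, ← Finset.sum_neg_distrib]
    congr 1
    · refine Finset.sum_congr rfl fun i _ ↦ ?_
      rw [List.eraseIdx_cons_succ, List.map_cons, List.prod_cons, pow_succ, ← mul_assoc,
        ← mul_assoc, mul_neg_one, neg_mul, neg_mul,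
        ((Commute.neg_one_right (osGen R M e)).pow_right i).eq]
    · simp

/-- The generators `∂(e₁ ⋯ eₖ)`, for the circuits `{e₁, …, eₖ}` of `M`. -/
def osRelations : Set (OSExterior R M) :=
  {x | ∃ l : List M.E, l.Nodup ∧ M.IsCircuit {e | ∃ h : e ∈ M.E, (⟨e, h⟩ : M.E) ∈ l} ∧
    x = osBoundary R M (l.map (osGen R M)).prod}

/-- The Orlik-Solomon ideal. -/
def osIdeal : TwoSidedIdeal (OSExterior R M) := TwoSidedIdeal.span (osRelations R M)

/-- The Orlik-Solomon algebra of `M` with coefficients in `R`. -/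
abbrev OSAlgebra : Type _ := (osIdeal R M).ringCon.Quotient

/-- The component of degree `k` of the Orlik-Solomon algebra: the image of the `k`-th exterior
power. -/
def osGraded (k : ℕ) : Submodule R (OSAlgebra R M) :=
  (⋀[R]^k (M.E →₀ R)).map ((osIdeal R M).ringCon.mkₐ R).toLinearMap

/-- The Orlik-Solomon algebras of `M` and `N` are isomorphic as graded `R`-algebras. -/
def OSIsomorphic {β : Type v} (N : Matroid β) : Prop :=
  ∃ φ : OSAlgebra R M ≃ₐ[R] OSAlgebra R N,
    ∀ k, (osGraded R M k).map φ.toLinearMap = osGraded R N k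

end OrlikSolomon

end Matroid

end

/-!
The isomorphism of Orlik-Solomon algebras comes from a linear change of generators. Write `a_j` for
the generators of the points of the polygon `C_n`, `b_x` for those of `M₀`, and `s` for that of the
isthmus; in the parallel connection `a_i` and `b_{e₀}` coincide. The boundary of a monomial is a
product of differences,
`∂(e_p e_{q₁} ⋯ e_{q_k}) = (e_{q₁} - e_p) ⋯ (e_{q_k} - e_p)` (`osBoundary_prod_cons`),
so the relation of a circuit depends only on the differences of the generators of its points. The
linear map `a_j ↦ a_j - b_{e₀} + s`, `b_x ↦ b_x` is invertible, with inverse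
`a_j ↦ a_j - a_i + b_{e₀}`, `b_x ↦ b_x`, `s ↦ a_i`, and it preserves the differences of the `a_j`
and those of the `b_x`. Hence it matches the relations of the circuits of `C_n` and of `M₀` in the
two algebras. The parallel connection has the further circuits `(C \ {i}) ∪ (C' \ {e₀})`, but their
relations lie in the ideal generated by the relations of `C` and `C'` (`osBoundary_append`). This is
`osIsomorphic_sum_parallelConnection`.

The Tutte polynomials are separated by their values at `(0, 1)`. By deletion and contraction this
value is nonnegative, it is positive for a matroid without isthmuses, and it vanishes for a matroid
with an isthmus (`eval_tutte_zero_one`, `tutte_ne_of_isColoop`). In `C_n ⊕ M₀` every point lies on a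
circuit, since `M₀` is connected with at least two points, while the other matroid has the
isthmus `S`.
-/

namespace Matroid

universe u v w

/-! ### The Tutte polynomial at `(0, 1)` -/

section Tutte

variable {α : Type u}

/-- The value of the Tutte polynomial at `(0, 1)` is nonnegative, and positive if there is no
isthmus: at a point that is not an isthmus the value is at least that of the contraction, and
contraction creates no isthmuses. The parameter `k` is the induction variable. -/
theorem eval_tutte_zero_one (k : ℕ) : ∀ (M : Matroid α) [M.Finite], M.E.ncard = k →
    0 ≤ MvPolynomial.eval ![0, 1] M.tutte ∧
      ((∀ e, ¬ M.IsColoop e) → 0 < MvPolynomial.eval ![0, 1] M.tutte) := by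
  induction k with
  | zero =>
    intro M _ h
    rw [ncard_eq_zero M.ground_finite] at h
    simp [tutte_of_ground_eq_empty M h]
  | succ k ih =>
    intro M _ h
    obtain ⟨e, he⟩ : M.E.Nonempty := nonempty_of_ncard_ne_zero (by omega)
    have hcard : (M.E \ {e}).ncard = k := by
      rw [ncard_sdiff_singleton_of_mem he, h, Nat.add_sub_cancel]
    obtain ⟨hd, -⟩ := ih (M.delete {e}) (by rw [delete_ground, hcard])
    obtain ⟨hc, hc'⟩ := ih (M.contract {e}) (by rw [contract_ground, hcard])
    have hpos : (∀ f, ¬ M.IsColoop f) →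
        0 < MvPolynomial.eval ![0, 1] (M.contract {e}).tutte := fun hM ↦
      hc' fun f hf ↦ hM f (contract_isColoop_iff.1 hf).1
    by_cases hco : M.IsColoop e
    · exact ⟨by simp [tutte_of_isColoop M hco], fun hM ↦ absurd hco (hM e)⟩
    by_cases hl : M.IsLoop e
    · have hdc : M.delete {e} = M.contract {e} :=
        (contract_eq_delete_of_subset_loops (singleton_subset_iff.2 hl)).symm
      have ht : MvPolynomial.eval ![0, 1] M.tutte =
          MvPolynomial.eval ![0, 1] (M.delete {e}).tutte := by
        simp [tutte_of_isLoop M hl]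
      rw [ht]
      simp only [hdc]
      exact ⟨hc, hpos⟩
    · rw [tutte_eq_delete_add_contract M he hl hco, map_add]
      exact ⟨add_nonneg hd hc, fun hM ↦ add_pos_of_nonneg_of_pos hd (hpos hM)⟩

theorem tutte_ne_of_isColoop {β : Type v} (M : Matroid α) (N : Matroid β) [M.Finite] [N.Finite]
    (hM : ∀ e, ¬ M.IsColoop e) {f : β} (hf : N.IsColoop f) : M.tutte ≠ N.tutte := by
  intro h
  have h1 := (eval_tutte_zero_one _ M rfl).2 hM
  rw [h, tutte_of_isColoop N hf] at h1
  simp at h1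

end Tutte

/-! ### Circuits, rank and restrictions of direct sums -/

section Sum

variable {α : Type u} {β : Type v}

theorem sum_indep_inl_image (M : Matroid α) (N : Matroid β) (I : Set α) :
    (M.sum N).Indep (Sum.inl '' I) ↔ M.Indep I := by
  have h1 : (Sum.inl ⁻¹' (Sum.inl '' I : Set (α ⊕ β)) : Set α) = I :=
    preimage_image_eq _ Sum.inl_injective
  have h2 : (Sum.inr ⁻¹' (Sum.inl '' I : Set (α ⊕ β)) : Set β) = ∅ := by ext; simp
  rw [sum_indep_iff, h1, h2, and_iff_left N.empty_indep]

theorem sum_indep_inr_image (M : Matroid α) (N : Matroid β) (I : Set β) :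
    (M.sum N).Indep (Sum.inr '' I) ↔ N.Indep I := by
  have h1 : (Sum.inr ⁻¹' (Sum.inr '' I : Set (α ⊕ β)) : Set β) = I :=
    preimage_image_eq _ Sum.inr_injective
  have h2 : (Sum.inl ⁻¹' (Sum.inr '' I : Set (α ⊕ β)) : Set α) = ∅ := by ext; simp
  rw [sum_indep_iff, h1, h2, and_iff_right M.empty_indep]

theorem isCircuit_iff_not_indep_and_forall_ssubset {M : Matroid α} {C : Set α} :
    M.IsCircuit C ↔ ¬ M.Indep C ∧ C ⊆ M.E ∧ ∀ I, I ⊂ C → M.Indep I := by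
  rw [isCircuit_iff_forall_ssubset, Dep, and_assoc]

theorem image_isCircuit_of_indep_iff {M : Matroid α} {N : Matroid β} {f : α → β}
    (hE : f '' M.E ⊆ N.E) (h : ∀ I, N.Indep (f '' I) ↔ M.Indep I)
    {C : Set α} (hC : M.IsCircuit C) : N.IsCircuit (f '' C) := by
  rw [isCircuit_iff_not_indep_and_forall_ssubset] at hC ⊢
  refine ⟨fun hi ↦ hC.1 ((h C).1 hi), (image_mono hC.2.1).trans hE, fun I hI ↦ ?_⟩
  obtain ⟨J, hJ, rfl⟩ := subset_image_iff.1 hI.subset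
  exact (h J).2 (hC.2.2 J (hJ.ssubset_of_ne fun he ↦ hI.ne (he ▸ rfl)))

theorem sum_isCircuit_inl {M : Matroid α} (N : Matroid β) {C : Set α} (hC : M.IsCircuit C) :
    (M.sum N).IsCircuit (Sum.inl '' C) :=
  image_isCircuit_of_indep_iff (by simp) (sum_indep_inl_image M N) hC

theorem sum_isCircuit_inr (M : Matroid α) {N : Matroid β} {C : Set β} (hC : N.IsCircuit C) :
    (M.sum N).IsCircuit (Sum.inr '' C) :=
  image_isCircuit_of_indep_iff (by simp) (sum_indep_inr_image M N) hC

/-- The circuits of a direct sum are those of the summands. -/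
theorem sum_isCircuit_iff {M : Matroid α} {N : Matroid β} {X : Set (α ⊕ β)} :
    (M.sum N).IsCircuit X ↔
      (∃ C, M.IsCircuit C ∧ X = Sum.inl '' C) ∨ ∃ C, N.IsCircuit C ∧ X = Sum.inr '' C := by
  refine ⟨fun hX ↦ ?_, ?_⟩
  · have hE := hX.subset_ground
    rw [sum_ground] at hE
    have hnot := hX.not_indep
    rw [sum_indep_iff, not_and_or] at hnot
    obtain h | h := hnot
    · obtain ⟨C, hCX, hC⟩ :=
        ((not_indep_iff (fun x hx ↦ by simpa using hE hx)).1 h).exists_isCircuit_subset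
      exact Or.inl ⟨C, hC, ((sum_isCircuit_inl N hC).eq_of_subset_isCircuit hX
        (image_subset_iff.2 hCX)).symm⟩
    · obtain ⟨C, hCX, hC⟩ :=
        ((not_indep_iff (fun x hx ↦ by simpa using hE hx)).1 h).exists_isCircuit_subset
      exact Or.inr ⟨C, hC, ((sum_isCircuit_inr M hC).eq_of_subset_isCircuit hX
        (image_subset_iff.2 hCX)).symm⟩
  · rintro (⟨C, hC, rfl⟩ | ⟨C, hC, rfl⟩)
    exacts [sum_isCircuit_inl N hC, sum_isCircuit_inr M hC]

theorem eRank_sum (M : Matroid α) (N : Matroid β) : (M.sum N).eRank = M.eRank + N.eRank := by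
  obtain ⟨B, hB⟩ := (M.sum N).exists_isBase
  obtain ⟨h1, h2⟩ := sum_isBase_iff.1 hB
  rw [← hB.encard_eq_eRank, ← h1.encard_eq_eRank, ← h2.encard_eq_eRank]
  conv_lhs => rw [← image_preimage_inl_union_image_preimage_inr B]
  rw [encard_union_eq, Sum.inl_injective.encard_image, Sum.inr_injective.encard_image]
  rw [Set.disjoint_left]
  rintro _ ⟨x, -, rfl⟩ ⟨y, -, h⟩
  cases h

theorem mapEmbedding_isRestriction {M : Matroid α} {N : Matroid β} (f : α ↪ β)
    (hE : f '' M.E ⊆ N.E) (h : ∀ I, I ⊆ M.E → (N.Indep (f '' I) ↔ M.Indep I)) :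
    (M.mapEmbedding f).IsRestriction N := by
  refine ⟨f '' M.E, hE, ext_indep rfl fun I hI ↦ ?_⟩
  obtain ⟨J, hJ, rfl⟩ := subset_image_iff.1 hI
  rw [mapEmbedding_indep_iff, restrict_indep_iff, preimage_image_eq _ f.injective, h J hJ]
  simp [image_mono hJ]

theorem not_isthmus_isCircuit (C : Set Unit) : ¬ isthmus.IsCircuit C :=
  fun hC ↦ hC.not_indep ((freeOn_indep_iff).2 (subset_univ C))

theorem eRank_isthmus : isthmus.eRank = 1 := by
  rw [isthmus, eRank_freeOn]
  simp

end Sum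

/-! ### The polygon matroid and the parallel connection -/

section Rank

theorem eRank_polygon {n : ℕ} (hn : 1 ≤ n) : (polygon n).eRank = ((n - 1 : ℕ) : ℕ∞) := by
  have hc : ({⟨0, hn⟩}ᶜ : Set (Fin n)).ncard = n - 1 := by
    rw [ncard_compl, ncard_singleton, Nat.card_fin]
  have hB : (polygon n).IsBase {⟨0, hn⟩}ᶜ := by
    refine (polygon_indep_iff.2 hc.le).isBase_of_forall_insert fun x hx h ↦ ?_
    rw [polygon_indep_iff, ncard_insert_of_notMem hx.2, hc] at h
    omega
  rw [← hB.encard_eq_eRank, ← (toFinite _).cast_ncard_eq, hc]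

variable {α : Type u} {β : Type v} {M : Matroid α} {N : Matroid β} [M.Finite] [N.Finite]
  {p : α} {q : β}

theorem parallelConnection_indep_inr_image (hp : M.IsNonloop p) (hq : N.IsNonloop q) (I : Set β) :
    (parallelConnection M N p q hp hq).Indep (Sum.inr '' I) ↔ N.Indep I := by
  have h1 : (Sum.inr ⁻¹' (Sum.inr '' I : Set ({x // x ≠ p} ⊕ β)) : Set β) = I :=
    preimage_image_eq _ Sum.inr_injective
  have h2 : (Sum.inl ⁻¹' (Sum.inr '' I : Set ({x // x ≠ p} ⊕ β)) : Set {x // x ≠ p}) = ∅ := by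
    ext; simp
  rw [parallelConnection_indep_iff, parallelIndep_iff hp hq, h1, h2, image_empty,
    and_iff_right M.empty_indep, and_iff_left]
  exact fun h ↦ hp.not_isLoop h.1

/-- If `D ∋ p` and `B ∋ q` are bases of `M` and `N`, then `(D \ {p}) ∪ B` is a base of the
parallel connection. -/
theorem eRank_parallelConnection (hp : M.IsNonloop p) (hq : N.IsNonloop q) :
    (parallelConnection M N p q hp hq).eRank + 1 = M.eRank + N.eRank := by
  obtain ⟨D, hD, hpD⟩ := hp.exists_mem_isBase
  obtain ⟨B, hB, hqB⟩ := hq.exists_mem_isBase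
  set X : Set ({x // x ≠ p} ⊕ β) := Sum.inl '' (Subtype.val ⁻¹' D) ∪ Sum.inr '' B with hX
  have hl : (Subtype.val '' (Sum.inl ⁻¹' X) : Set α) = D \ {p} := by
    ext x
    simp [hX, and_comm]
  have hr : Sum.inr ⁻¹' X = B := by
    ext x
    simp [hX]
  have hqcl : q ∈ N.closure B := N.mem_closure_of_mem hqB hB.subset_ground
  have hbase : (parallelConnection M N p q hp hq).IsBase X := by
    refine Indep.isBase_of_forall_insert ?_ ?_
    · rw [parallelConnection_indep_iff, parallelIndep_iff hp hq, hl, hr]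
      exact ⟨hD.indep.subset sdiff_subset, hB.indep,
        fun h ↦ hD.indep.notMem_closure_sdiff_of_mem hpD h.1⟩
    · rintro x ⟨hxE, hxX⟩ hi
      rw [parallelConnection_indep_iff, parallelIndep_iff hp hq] at hi
      obtain ⟨h1, h2, h3⟩ := hi
      obtain x | y := x
      · have e1 : (Subtype.val '' (Sum.inl ⁻¹' (insert (Sum.inl x) X)) : Set α) =
            insert x.1 (D \ {p}) := by
          rw [← hl, ← image_insert_eq]
          congr 1
          ext
          simp
        have e2 : (Sum.inr ⁻¹' (insert (Sum.inl x) X) : Set β) = B := by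
          rw [← hr]
          ext
          simp
        rw [e1] at h1 h3
        rw [e2] at h3
        have hxD : x.1 ∉ D := fun h ↦ hxX (Or.inl ⟨x, h, rfl⟩)
        refine h3 ⟨?_, hqcl⟩
        rw [(hD.exchange_isBase_of_indep hxD h1).closure_eq]
        exact hp.mem_ground
      · have e2 : (Sum.inr ⁻¹' (insert (Sum.inr y) X) : Set β) = insert y B := by
          rw [← hr]
          ext
          simp
        rw [e2] at h2
        have hyB : y ∉ B := fun h ↦ hxX (Or.inr ⟨y, h, rfl⟩)
        exact hyB (hB.mem_of_insert_indep h2)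
  rw [← hbase.encard_eq_eRank, ← hD.encard_eq_eRank, ← hB.encard_eq_eRank, parallel_encard, hl, hr,
    ← encard_sdiff_singleton_add_one hpD]
  ring

end Rank

/-! ### Relations and isomorphisms of Orlik-Solomon algebras -/

section OrlikSolomon

variable {R : Type w} [CommRing R] {α : Type u} {M : Matroid α} {β : Type v} {N : Matroid β}

theorem osGen_mul_self (p : M.E) : osGen R M p * osGen R M p = 0 :=
  ExteriorAlgebra.ι_sq_zero _

theorem osGen_mul_swap (p q : M.E) :
    osGen R M p * osGen R M q = -(osGen R M q * osGen R M p) :=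
  eq_neg_of_add_eq_zero_left (ExteriorAlgebra.ι_add_mul_swap _ _)

/-- The boundary of a nonempty monomial is a product of differences of generators. -/
theorem osBoundary_prod_cons (p : M.E) (l : List M.E) :
    osBoundary R M ((p :: l).map (osGen R M)).prod =
      (l.map fun q ↦ osGen R M q - osGen R M p).prod := by
  rw [List.map_cons, List.prod_cons, osBoundary_osGen_mul]
  induction l with
  | nil => simp [osBoundary_one]
  | cons q l ih =>
    rw [List.map_cons, List.prod_cons, List.map_cons, List.prod_cons, ← ih, osBoundary_osGen_mul]
    have h1 := osGen_mul_self (R := R) p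
    have h2 := osGen_mul_swap (R := R) p q
    generalize osBoundary R M (l.map (osGen R M)).prod = D
    generalize (l.map (osGen R M)).prod = P
    generalize osGen R M p = a at *
    generalize osGen R M q = b at *
    have h3 : a * (b * D) = -(b * (a * D)) := by rw [← mul_assoc, h2, neg_mul, mul_assoc]
    have h4 : a * (a * D) = 0 := by rw [← mul_assoc, h1, zero_mul]
    simp only [mul_sub, sub_mul, h3, h4]
    abel

/-- The Leibniz rule for `∂`, with a monomial as the left factor. -/
theorem osBoundary_prod_mul (l : List M.E) (x : OSExterior R M) :
    osBoundary R M ((l.map (osGen R M)).prod * x) =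
      osBoundary R M (l.map (osGen R M)).prod * x +
        (-1) ^ l.length * ((l.map (osGen R M)).prod * osBoundary R M x) := by
  induction l with
  | nil => simp [osBoundary_one]
  | cons p l ih =>
    rw [List.map_cons, List.prod_cons, mul_assoc, osBoundary_osGen_mul, osBoundary_osGen_mul, ih,
      List.length_cons, pow_succ]
    have h := ((Commute.neg_one_right (osGen R M p)).pow_right l.length).eq
    simp only [mul_add, sub_mul, mul_neg_one, neg_mul, ← mul_assoc, h]
    abel

theorem prod_mul_osGen (l : List M.E) (p : M.E) :
    (l.map (osGen R M)).prod * osGen R M p =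
      (-1) ^ l.length * (osGen R M p * (l.map (osGen R M)).prod) := by
  induction l with
  | nil => simp
  | cons q l ih =>
    have h := ((Commute.neg_one_right (osGen R M q)).pow_right l.length).eq
    rw [List.map_cons, List.prod_cons, mul_assoc, ih, List.length_cons, pow_succ, ← mul_assoc,
      h, mul_assoc, ← mul_assoc (osGen R M q), osGen_mul_swap q p]
    simp [mul_assoc]

theorem osBoundary_prod_mul_osGen (l : List M.E) (p : M.E) :
    osBoundary R M (l.map (osGen R M)).prod * osGen R M p =
      -((-1) ^ l.length * (osGen R M p * osBoundary R M (l.map (osGen R M)).prod)) := by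
  have h := congrArg (osBoundary R M) (prod_mul_osGen (R := R) l p)
  have hs (x : OSExterior R M) :
      osBoundary R M ((-1) ^ l.length * x) = (-1) ^ l.length * osBoundary R M x := by
    rcases neg_one_pow_eq_or (OSExterior R M) l.length with h | h <;> simp [h]
  have h1 : osBoundary R M (osGen R M p) = 1 := by
    simpa [osBoundary_one] using osBoundary_osGen_mul R M p 1
  rw [osBoundary_prod_mul, hs, osBoundary_osGen_mul, h1, mul_one, mul_sub] at h
  rw [← sub_eq_zero] at h ⊢
  rw [← h]
  abel

/-- If `p :: l₁` and `p :: l₂` enumerate circuits, then `∂` of the monomial of `l₁ ++ l₂` lies in the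
ideal generated by the relations of these two circuits. -/
theorem osBoundary_append (p : M.E) (l₁ l₂ : List M.E) :
    osBoundary R M ((l₁ ++ l₂).map (osGen R M)).prod =
      (-1) ^ l₁.length * (osBoundary R M ((p :: l₁).map (osGen R M)).prod *
        osBoundary R M (l₂.map (osGen R M)).prod) +
      osBoundary R M (l₁.map (osGen R M)).prod *
        osBoundary R M ((p :: l₂).map (osGen R M)).prod := by
  rw [List.map_append, List.prod_append, osBoundary_prod_mul]
  simp only [List.map_cons, List.prod_cons, osBoundary_osGen_mul, mul_sub, sub_mul]
  rw [← mul_assoc _ (osGen R M p), osBoundary_prod_mul_osGen]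
  simp only [neg_mul, mul_assoc]
  abel

theorem prod_osGen_perm {l l' : List M.E} (h : l.Perm l') :
    (l.map (osGen R M)).prod = (l'.map (osGen R M)).prod ∨
      (l.map (osGen R M)).prod = -(l'.map (osGen R M)).prod := by
  induction h with
  | nil => exact Or.inl rfl
  | cons p _ ih => rcases ih with h | h <;> simp [h]
  | swap p q l =>
    right
    simp only [List.map_cons, List.prod_cons, ← mul_assoc]
    rw [osGen_mul_swap, neg_mul]
  | trans _ _ h₁ h₂ => rcases h₁ with h₁ | h₁ <;> rcases h₂ with h₂ | h₂ <;> simp [h₁, h₂]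

/-- An algebra map that preserves the differences of generators preserves the boundaries of nonempty
monomials. -/
theorem map_osBoundary_prod {ι : Type*} {φ : OSExterior R M →ₐ[R] OSExterior R N} {f : ι → M.E}
    {g : ι → N.E} (h : ∀ i j, φ (osGen R M (f i) - osGen R M (f j)) =
      osGen R N (g i) - osGen R N (g j)) {l : List ι} (hl : l ≠ []) :
    φ (osBoundary R M ((l.map f).map (osGen R M)).prod) =
      osBoundary R N ((l.map g).map (osGen R N)).prod := by
  obtain ⟨i, l, rfl⟩ := List.exists_cons_of_ne_nil hl
  rw [List.map_cons (f := f), List.map_cons (f := g), osBoundary_prod_cons, osBoundary_prod_cons,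
    map_list_prod]
  simp [Function.comp_def, ← h]

/-- The relation of a circuit enumerated through an injective map `f` from another type. -/
theorem osBoundary_mem_osIdeal {ι : Type*} {f : ι → M.E} (hf : Function.Injective f) {l : List ι}
    (hl : l.Nodup) {C : Set α} (hC : M.IsCircuit C) (hlC : C = (fun i ↦ (f i).1) '' {i | i ∈ l}) :
    osBoundary R M ((l.map f).map (osGen R M)).prod ∈ osIdeal R M := by
  refine TwoSidedIdeal.subset_span ⟨l.map f, hl.map hf, ?_, rfl⟩
  convert hC
  rw [hlC]
  ext e
  simp only [List.mem_map, mem_ofPred_eq, mem_image]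
  constructor
  · rintro ⟨h, i, hi, hie⟩
    exact ⟨i, hi, by rw [hie]⟩
  · rintro ⟨i, hi, rfl⟩
    exact ⟨(f i).2, i, hi, rfl⟩

/-- A list of points of `M` whose set of members is the image of `S` under an injective map `f` is
the image of a list that enumerates `S`. -/
theorem exists_list_map_eq {ι : Type*} {f : ι → M.E} {l : List M.E} (hl : l.Nodup)
    {S : Set ι} (hS : {e | ∃ h : e ∈ M.E, (⟨e, h⟩ : M.E) ∈ l} = (fun i ↦ (f i).1) '' S)
    (hf : Function.Injective f) : ∃ l' : List ι, l'.Nodup ∧ l = l'.map f ∧ {i | i ∈ l'} = S := by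
  have hr : l ∈ range (List.map f) := by
    rw [range_list_map]
    rintro ⟨e, he⟩ hel
    obtain ⟨i, -, hi⟩ := hS.subset ⟨he, hel⟩
    exact ⟨i, Subtype.ext hi⟩
  obtain ⟨l', rfl⟩ := hr
  refine ⟨l', hl.of_map f, rfl, ?_⟩
  ext i
  have := Set.ext_iff.1 hS (f i).1
  rw [(Subtype.val_injective.comp hf).mem_set_image (f := fun i ↦ (f i).1)] at this
  simpa [hf.eq_iff] using this

theorem map_mem_osIdeal {φ : OSExterior R M →ₐ[R] OSExterior R N}
    (h : ∀ x ∈ osRelations R M, φ x ∈ osIdeal R N) {x : OSExterior R M} (hx : x ∈ osIdeal R M) :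
    φ x ∈ osIdeal R N := by
  have : osIdeal R M ≤ (osIdeal R N).comap φ :=
    TwoSidedIdeal.span_le.2 fun x hx ↦ (TwoSidedIdeal.mem_comap φ).2 (h x hx)
  exact (TwoSidedIdeal.mem_comap φ).1 (this hx)

/-- A linear isomorphism of the free modules on the points that, together with its inverse, carries
the relations of each matroid into the ideal of the other induces a graded isomorphism of
Orlik-Solomon algebras. -/
theorem osIsomorphic_of_linearEquiv (σ : (M.E →₀ R) ≃ₗ[R] (N.E →₀ R))
    (h₁ : ∀ x ∈ osRelations R M, ExteriorAlgebra.map σ.toLinearMap x ∈ osIdeal R N)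
    (h₂ : ∀ x ∈ osRelations R N, ExteriorAlgebra.map σ.symm.toLinearMap x ∈ osIdeal R M) :
    OSIsomorphic R M N := by
  let e : OSExterior R M ≃ₐ[R] OSExterior R N := AlgEquiv.ofAlgHom
    (ExteriorAlgebra.map σ.toLinearMap) (ExteriorAlgebra.map σ.symm.toLinearMap)
    (by rw [ExteriorAlgebra.map_comp_map]; simp)
    (by rw [ExteriorAlgebra.map_comp_map]; simp)
  have k₁ : ∀ x ∈ osIdeal R M, e x ∈ osIdeal R N := fun x hx ↦ map_mem_osIdeal h₁ hx
  have k₂ : ∀ x ∈ osIdeal R N, e.symm x ∈ osIdeal R M := fun x hx ↦ map_mem_osIdeal h₂ hx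
  have hcon : (osIdeal R M).ringCon = (osIdeal R N).ringCon.comap (e : OSExterior R M →+* _) := by
    ext x y
    rw [RingCon.comap_rel, TwoSidedIdeal.rel_iff, TwoSidedIdeal.rel_iff]
    refine ⟨fun h ↦ by simpa using k₁ _ h, fun h ↦ by simpa using k₂ _ h⟩
  refine ⟨RingCon.congrₐ R e hcon, fun k ↦ ?_⟩
  have hcomp : (RingCon.congrₐ R e hcon).toLinearMap ∘ₗ
      ((osIdeal R M).ringCon.mkₐ R).toLinearMap =
      ((osIdeal R N).ringCon.mkₐ R).toLinearMap ∘ₗ e.toLinearMap := rfl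
  have hpow : (⋀[R]^k (M.E →₀ R)).map e.toLinearMap = ⋀[R]^k (N.E →₀ R) := by
    have hm : (LinearMap.range (ExteriorAlgebra.ι R (M := M.E →₀ R))).map e.toLinearMap =
        LinearMap.range (ExteriorAlgebra.ι R (M := N.E →₀ R)) := by
      rw [← LinearMap.range_comp]
      have : e.toLinearMap ∘ₗ ExteriorAlgebra.ι R = ExteriorAlgebra.ι R ∘ₗ σ.toLinearMap :=
        ExteriorAlgebra.map_comp_ι _
      rw [this, LinearMap.range_comp, LinearEquiv.range, Submodule.map_top]
    change Submodule.map _ (LinearMap.range (ExteriorAlgebra.ι R (M := M.E →₀ R)) ^ k) =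
      LinearMap.range (ExteriorAlgebra.ι R (M := N.E →₀ R)) ^ k
    rw [← hm]
    exact Submodule.map_pow _ e.toAlgHom k
  rw [osGraded, osGraded, ← Submodule.map_comp, ← hpow, ← Submodule.map_comp]
  exact congrArg (fun f ↦ (⋀[R]^k (M.E →₀ R)).map f) hcomp

end OrlikSolomon

/-! ### The isomorphism for the two matroids -/

section Isomorphism

/-- The Orlik-Solomon algebras of `C_n ⊕ M₀` and `P(C_n, M₀) ⊕ S` are isomorphic. -/
theorem osIsomorphic_sum_parallelConnection (R : Type w) [CommRing R] {α : Type u}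
    (M₀ : Matroid α) [M₀.Finite] {n : ℕ} (hn : 1 ≤ n) {i : Fin n} {e₀ : α}
    (hi : (polygon n).IsNonloop i) (he₀ : M₀.IsNonloop e₀) :
    OSIsomorphic R ((polygon n).sum M₀)
      ((parallelConnection (polygon n) M₀ i e₀ hi he₀).sum isthmus) := by
  set M := (polygon n).sum M₀ with hM
  set P := parallelConnection (polygon n) M₀ i e₀ hi he₀ with hP
  set N := P.sum isthmus with hN
  -- The points of both matroids: those of the polygon, those of `M₀`, and the isthmus `s`.
  let a : Fin n → M.E := fun j ↦ ⟨Sum.inl j, by simp [hM]⟩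
  let b : M₀.E → M.E := fun x ↦ ⟨Sum.inr x.1, by simp [hM]⟩
  let a' : Fin n → N.E := fun j ↦ ⟨Sum.inl (glue i e₀ j), by
    rw [hN, sum_ground, hP, parallelConnection_ground]
    exact Or.inl (mem_image_of_mem _ (Or.inl (mem_image_of_mem _ (mem_univ j))))⟩
  let b' : M₀.E → N.E := fun x ↦ ⟨Sum.inl (Sum.inr x.1), by
    rw [hN, sum_ground, hP, parallelConnection_ground]
    exact Or.inl (mem_image_of_mem _ (Or.inr (mem_image_of_mem _ x.2)))⟩
  let s : N.E := ⟨Sum.inr (), by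
    rw [hN, sum_ground]
    exact Or.inr (mem_image_of_mem _ (mem_univ _))⟩
  let f₀ : M₀.E := ⟨e₀, he₀.mem_ground⟩
  have ha : Function.Injective a := fun j k h ↦ Sum.inl_injective (congrArg Subtype.val h)
  have hb : Function.Injective b := fun x y h ↦
    Subtype.ext (Sum.inr_injective (congrArg Subtype.val h))
  have ha' : Function.Injective a' := fun j k h ↦
    glue_injective i e₀ (Sum.inl_injective (congrArg Subtype.val h))
  have hb' : Function.Injective b' := fun x y h ↦
    Subtype.ext (Sum.inr_injective (Sum.inl_injective (congrArg Subtype.val h)))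
  have hab : a' i = b' f₀ := Subtype.ext (congrArg Sum.inl (glue_self i e₀))
  have hmemM : ∀ x, Sum.inr x ∈ M.E → x ∈ M₀.E := fun x hx ↦ by simpa [hM] using hx
  have hmemN : ∀ x, Sum.inl (Sum.inr x) ∈ N.E → x ∈ M₀.E := fun x hx ↦ by
    rw [hN, sum_ground] at hx
    refine (inr_mem_parallelGround (M := polygon n) (p := i) he₀.mem_ground).1 ?_
    exact (by simpa using hx : Sum.inr x ∈ P.E)
  let v : M.E → (N.E →₀ R) := fun
    | ⟨Sum.inl j, _⟩ => Finsupp.single (a' j) 1 - Finsupp.single (b' f₀) 1 + Finsupp.single s 1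
    | ⟨Sum.inr x, hx⟩ => Finsupp.single (b' ⟨x, hmemM x hx⟩) 1
  let w : N.E → (M.E →₀ R) := fun
    | ⟨Sum.inl (Sum.inl j), _⟩ =>
      Finsupp.single (a j) 1 - Finsupp.single (a i) 1 + Finsupp.single (b f₀) 1
    | ⟨Sum.inl (Sum.inr x), hx⟩ => Finsupp.single (b ⟨x, hmemN x hx⟩) 1
    | ⟨Sum.inr _, _⟩ => Finsupp.single (a i) 1
  let V := Finsupp.linearCombination R v
  let W := Finsupp.linearCombination R w
  have hVa (j) : V (Finsupp.single (a j) 1) =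
      Finsupp.single (a' j) 1 - Finsupp.single (b' f₀) 1 + Finsupp.single s 1 := by
    simp [V, v, a]
  have hVb (x) : V (Finsupp.single (b x) 1) = Finsupp.single (b' x) 1 := by
    simp [V, v, b]
  have hWb (x) : W (Finsupp.single (b' x) 1) = Finsupp.single (b x) 1 := by
    simp [W, w, b']
  have hWs : W (Finsupp.single s 1) = Finsupp.single (a i) 1 := by
    simp [W, w, s]
  -- For `j = i` the formula reads `a' i ↦ b f₀`, in accordance with `a' i = b' f₀`.
  have hWa (j) : W (Finsupp.single (a' j) 1) =
      Finsupp.single (a j) 1 - Finsupp.single (a i) 1 + Finsupp.single (b f₀) 1 := by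
    by_cases hj : j = i
    · rw [hj, hab, hWb, sub_self, zero_add]
    · have : a' j = ⟨Sum.inl (Sum.inl ⟨j, hj⟩), by
          rw [← glue_of_ne e₀ hj]; exact (a' j).2⟩ :=
        Subtype.ext (congrArg Sum.inl (glue_of_ne e₀ hj))
      rw [this]
      simp [W, w]
  have hVW : V ∘ₗ W = LinearMap.id := by
    ext1 ⟨x, hx⟩
    ext1
    obtain (⟨j, hj⟩ | x) | x := x
    · have : (⟨Sum.inl (Sum.inl ⟨j, hj⟩), hx⟩ : N.E) = a' j :=
        Subtype.ext (congrArg Sum.inl (glue_of_ne e₀ hj).symm)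
      simp only [LinearMap.comp_apply, Finsupp.lsingle_apply, LinearMap.id_apply, this, hWa,
        map_add, map_sub, hVa, hVb, hab]
      abel
    · change V (W (Finsupp.single (b' ⟨x, hmemN x hx⟩) 1)) =
        Finsupp.single (b' ⟨x, hmemN x hx⟩) 1
      rw [hWb, hVb]
    · change V (W (Finsupp.single s 1)) = Finsupp.single s 1
      rw [hWs, hVa, hab]
      abel
  have hWV : W ∘ₗ V = LinearMap.id := by
    ext1 ⟨x, hx⟩
    ext1
    obtain j | x := x
    · change W (V (Finsupp.single (a j) 1)) = Finsupp.single (a j) 1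
      simp only [hVa, map_add, map_sub, hWa, hWb, hWs]
      abel
    · change W (V (Finsupp.single (b ⟨x, hmemM x hx⟩) 1)) =
        Finsupp.single (b ⟨x, hmemM x hx⟩) 1
      rw [hVb, hWb]
  have hn0 : ∀ {l : List (Fin n)}, {j | j ∈ l} = univ → l ≠ [] := by
    rintro l hl rfl
    exact absurd (hl.symm.subset (mem_univ i)) List.not_mem_nil
  have hx0 : ∀ {l : List M₀.E} {C}, M₀.IsCircuit C → Subtype.val '' {x | x ∈ l} = C → l ≠ [] := by
    rintro l C hC hl rfl
    rw [← hl] at hC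
    simpa using hC.nonempty
  have hMa : M.IsCircuit (Sum.inl '' univ) :=
    sum_isCircuit_inl M₀ ((polygon_isCircuit_iff hn).2 rfl)
  have hMb : ∀ {C}, M₀.IsCircuit C → M.IsCircuit (Sum.inr '' C) := sum_isCircuit_inr _
  have hNa : N.IsCircuit (Sum.inl '' (glue i e₀ '' univ)) := sum_isCircuit_inl isthmus
    ((parallelConnection_isCircuit_iff _ _ _ _ _ _).2
      (Or.inl (Or.inl ⟨univ, (polygon_isCircuit_iff hn).2 rfl, rfl⟩)))
  have hNb : ∀ {C}, M₀.IsCircuit C → N.IsCircuit (Sum.inl '' (Sum.inr '' C)) := fun {C} hC ↦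
    sum_isCircuit_inl isthmus ((parallelConnection_isCircuit_iff _ _ _ _ _ _).2
      (Or.inl (Or.inr ⟨C, hC, rfl⟩)))
  have hlift : ∀ {C}, M₀.IsCircuit C → ∃ S : Set M₀.E, Subtype.val '' S = C := fun {C} hC ↦
    ⟨Subtype.val ⁻¹' C, by simpa using hC.subset_ground⟩
  -- Both maps preserve the differences of the generators along each of the two given matroids.
  have dVa (j k) : ExteriorAlgebra.map V (osGen R M (a j) - osGen R M (a k)) =
      osGen R N (a' j) - osGen R N (a' k) := by
    simp only [osGen, ← map_sub, ExteriorAlgebra.map_apply_ι]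
    rw [map_sub, hVa, hVa]
    congr 1
    abel
  have dVb (x y) : ExteriorAlgebra.map V (osGen R M (b x) - osGen R M (b y)) =
      osGen R N (b' x) - osGen R N (b' y) := by
    simp only [osGen, ← map_sub, ExteriorAlgebra.map_apply_ι]
    rw [map_sub, hVb, hVb]
  have dWa (j k) : ExteriorAlgebra.map W (osGen R N (a' j) - osGen R N (a' k)) =
      osGen R M (a j) - osGen R M (a k) := by
    simp only [osGen, ← map_sub, ExteriorAlgebra.map_apply_ι]
    rw [map_sub, hWa, hWa]
    congr 1
    abel
  have dWb (x y) : ExteriorAlgebra.map W (osGen R N (b' x) - osGen R N (b' y)) =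
      osGen R M (b x) - osGen R M (b y) := by
    simp only [osGen, ← map_sub, ExteriorAlgebra.map_apply_ι]
    rw [map_sub, hWb, hWb]
  have rel_a : ∀ {l : List (Fin n)}, l.Nodup → {j | j ∈ l} = univ →
      ExteriorAlgebra.map W (osBoundary R N ((l.map a').map (osGen R N)).prod) ∈ osIdeal R M := by
    intro l hl hlu
    rw [map_osBoundary_prod dWa (hn0 hlu)]
    exact osBoundary_mem_osIdeal ha hl hMa (by rw [hlu])
  have rel_b : ∀ {l : List M₀.E} {C}, l.Nodup → M₀.IsCircuit C → Subtype.val '' {x | x ∈ l} = C →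
      ExteriorAlgebra.map W (osBoundary R N ((l.map b').map (osGen R N)).prod) ∈ osIdeal R M := by
    intro l C hl hC hlC
    rw [map_osBoundary_prod dWb (hx0 hC hlC)]
    exact osBoundary_mem_osIdeal hb hl (hMb hC) (by rw [← hlC, image_image])
  refine osIsomorphic_of_linearEquiv (LinearEquiv.ofLinearMap V W hVW hWV) ?_ ?_
  · rintro _ ⟨l, hl, hX, rfl⟩
    obtain ⟨C, hC, hlC⟩ | ⟨C, hC, hlC⟩ := sum_isCircuit_iff.1 hX
    · obtain rfl := (polygon_isCircuit_iff hn).1 hC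
      obtain ⟨l, hl', rfl, hlu⟩ := exists_list_map_eq (f := a) hl hlC ha
      change ExteriorAlgebra.map V _ ∈ _
      rw [map_osBoundary_prod dVa (hn0 hlu)]
      exact osBoundary_mem_osIdeal ha' hl' hNa (by rw [hlu, image_image])
    · obtain ⟨S, rfl⟩ := hlift hC
      rw [image_image] at hlC
      obtain ⟨l, hl', rfl, hlS⟩ := exists_list_map_eq (f := b) hl hlC hb
      change ExteriorAlgebra.map V _ ∈ _
      rw [map_osBoundary_prod dVb (hx0 hC (by rw [hlS]))]
      exact osBoundary_mem_osIdeal hb' hl' (hNb hC) (by rw [hlS, image_image, image_image])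
  · rintro _ ⟨l, hl, hX, rfl⟩
    change ExteriorAlgebra.map W _ ∈ _
    obtain ⟨X, hX, hlX⟩ | ⟨C, hC, -⟩ := sum_isCircuit_iff.1 hX
    swap
    · exact absurd hC (not_isthmus_isCircuit C)
    obtain ((⟨C, hC, rfl⟩ | ⟨C', hC', rfl⟩) | ⟨C, C', hC, -, hC', hqC, rfl⟩) :=
      (parallelConnection_isCircuit_iff _ _ _ _ _ _).1 hX
    · obtain rfl := (polygon_isCircuit_iff hn).1 hC
      rw [image_image] at hlX
      obtain ⟨l, hl', rfl, hlu⟩ := exists_list_map_eq (f := a') hl hlX ha'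
      exact rel_a hl' hlu
    · obtain ⟨S, rfl⟩ := hlift hC'
      rw [image_image, image_image] at hlX
      obtain ⟨l, hl', rfl, hlS⟩ := exists_list_map_eq (f := b') hl hlX hb'
      exact rel_b hl' hC' (by rw [hlS])
    · obtain rfl := (polygon_isCircuit_iff hn).1 hC
      obtain ⟨S, rfl⟩ := hlift hC'
      have hf₀ : f₀ ∈ S := by
        obtain ⟨x, hx, hxe⟩ := hqC
        rwa [show f₀ = x from Subtype.ext hxe.symm]
      have : Finite M₀.E := M₀.ground_finite
      -- Up to sign the relation is that of the polygon points other than `i`, followed by the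
      -- points of `C'` other than `e₀`.
      obtain ⟨l₁, hl₁, hl₁'⟩ : ∃ l₁ : List (Fin n), l₁.Nodup ∧ ∀ j, j ∈ l₁ ↔ j ≠ i :=
        ⟨(Finset.univ.erase i).toList, Finset.nodup_toList _, by simp⟩
      obtain ⟨l₂, hl₂, hl₂'⟩ : ∃ l₂ : List M₀.E, l₂.Nodup ∧ ∀ x, x ∈ l₂ ↔ x ∈ S ∧ x ≠ f₀ :=
        ⟨(toFinite (S \ {f₀})).toFinset.toList, Finset.nodup_toList _, by simp⟩
      have hperm : l.Perm (l₁.map a' ++ l₂.map b') := by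
        rw [List.perm_ext_iff_of_nodup hl]
        · rintro ⟨x, hx⟩
          have hmem : (⟨x, hx⟩ : N.E) ∈ l ↔ x ∈ Sum.inl '' (glue i e₀ '' (univ \ {i}) ∪
              Sum.inr '' (Subtype.val '' S \ {e₀})) := by
            rw [← hlX]
            exact ⟨fun h ↦ ⟨hx, h⟩, fun ⟨_, h⟩ ↦ h⟩
          rw [hmem, List.mem_append, List.mem_map, List.mem_map]
          constructor
          · rintro ⟨_, ⟨j, hj, rfl⟩ | ⟨_, ⟨⟨y, hy, rfl⟩, hne⟩, rfl⟩, rfl⟩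
            · exact Or.inl ⟨j, (hl₁' j).2 hj.2, rfl⟩
            · exact Or.inr ⟨y, (hl₂' y).2 ⟨hy, fun h ↦ hne (congrArg Subtype.val h)⟩, rfl⟩
          · rintro (⟨j, hj, h⟩ | ⟨y, hy, h⟩) <;> obtain rfl := congrArg Subtype.val h
            · exact mem_image_of_mem _ (Or.inl (mem_image_of_mem _ ⟨mem_univ j, (hl₁' j).1 hj⟩))
            · obtain ⟨hyS, hyf⟩ := (hl₂' y).1 hy
              exact mem_image_of_mem _ (Or.inr (mem_image_of_mem _
                ⟨mem_image_of_mem _ hyS, fun h ↦ hyf (Subtype.ext h)⟩))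
        · rw [List.nodup_append']
          refine ⟨hl₁.map ha', hl₂.map hb', ?_⟩
          intro z hz₁ hz₂
          obtain ⟨j, hj, rfl⟩ := List.mem_map.1 hz₁
          obtain ⟨y, -, hy⟩ := List.mem_map.1 hz₂
          have h := Sum.inl_injective (congrArg Subtype.val hy)
          rw [glue_of_ne e₀ ((hl₁' j).1 hj)] at h
          cases h
      have key : ExteriorAlgebra.map W
          (osBoundary R N ((l₁.map a' ++ l₂.map b').map (osGen R N)).prod) ∈ osIdeal R M := by
        rw [osBoundary_append (b' f₀), map_add, map_mul, map_mul, map_mul]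
        refine add_mem (TwoSidedIdeal.mul_mem_left _ _ _ (TwoSidedIdeal.mul_mem_right _ _ _ ?_))
          (TwoSidedIdeal.mul_mem_left _ _ _ ?_)
        · rw [← hab, ← List.map_cons]
          refine rel_a (List.nodup_cons.2 ⟨fun h ↦ (hl₁' i).1 h rfl, hl₁⟩) ?_
          ext j
          simp [hl₁', em]
        · rw [← List.map_cons]
          refine rel_b (List.nodup_cons.2 ⟨fun h ↦ ((hl₂' f₀).1 h).2 rfl, hl₂⟩) hC' ?_
          congr 1
          ext x
          by_cases hx : x = f₀ <;> simp [hl₂', hx, hf₀]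
      obtain h | h := prod_osGen_perm (R := R) hperm
      · rwa [h]
      · rw [h, map_neg, map_neg]
        exact neg_mem key

end Isomorphism

end Matroid

theorem theorem1 {α : Type*} (M₀ : Matroid α) [M₀.Finite] (hsimple : M₀.IsSimple)
    (hconn : M₀.IsConnected) (hE : M₀.E.Nontrivial) (n : ℕ) (hn : 3 ≤ n)
    (i : Fin n) (e₀ : α) (he₀ : e₀ ∈ M₀.E) :
    let M := (Matroid.polygon n).sum M₀
    let M' := (Matroid.parallelConnection (Matroid.polygon n) M₀ i e₀
      (Matroid.polygon_isNonloop (by omega) i) (hsimple.isNonloop he₀)).sum Matroid.isthmus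
    M.eRank = M₀.eRank + ((n - 1 : ℕ) : ℕ∞) ∧
    M'.eRank = M₀.eRank + ((n - 1 : ℕ) : ℕ∞) ∧
    (M₀.mapEmbedding Function.Embedding.inr).IsRestriction M ∧
    (M₀.mapEmbedding (Function.Embedding.inr.trans Function.Embedding.inl)).IsRestriction M' ∧
    (∀ (R : Type*) [CommRing R], Matroid.OSIsomorphic R M M') ∧
    M.tutte ≠ M'.tutte := by
  intro M M'
  refine ⟨?_, ?_, ?_, ?_, ?_, ?_⟩
  · rw [Matroid.eRank_sum, Matroid.eRank_polygon (by omega), add_comm]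
  · rw [Matroid.eRank_sum, Matroid.eRank_isthmus, Matroid.eRank_parallelConnection,
      Matroid.eRank_polygon (by omega), add_comm]
  · exact Matroid.mapEmbedding_isRestriction _ (by simp [M])
      fun I _ ↦ Matroid.sum_indep_inr_image _ _ I
  · refine Matroid.mapEmbedding_isRestriction _ ?_ fun I _ ↦ ?_
    · rintro _ ⟨x, hx, rfl⟩
      rw [Matroid.sum_ground, Matroid.parallelConnection_ground]
      exact Or.inl (mem_image_of_mem _ (Or.inr (mem_image_of_mem _ hx)))
    · have h := Matroid.sum_indep_inl_image (Matroid.parallelConnection (Matroid.polygon n) M₀ i e₀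
        (Matroid.polygon_isNonloop (by omega) i) (hsimple.isNonloop he₀)) Matroid.isthmus
        (Sum.inr '' I)
      rw [image_image] at h
      exact h.trans (Matroid.parallelConnection_indep_inr_image _ _ I)
  · exact fun R _ ↦ Matroid.osIsomorphic_sum_parallelConnection R M₀ (by omega) _ _
  · refine Matroid.tutte_ne_of_isColoop M M' ?_ (f := Sum.inr ()) ?_
    · rintro (j | x) hco
      · exact (Matroid.sum_isCircuit_inl M₀
          ((Matroid.polygon_isCircuit_iff (by omega)).2 rfl)).not_isColoop_of_mem
          (mem_image_of_mem _ (mem_univ j)) hco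
      · have hx : x ∈ M₀.E := by simpa [M] using hco.mem_ground
        obtain ⟨y, hy, hyx⟩ := hE.exists_ne x
        obtain ⟨C, hC, hxC, -⟩ := hconn x hx y hy hyx.symm
        exact (Matroid.sum_isCircuit_inr _ hC).not_isColoop_of_mem (mem_image_of_mem _ hxC) hco
    · rw [Matroid.isColoop_iff_forall_notMem_isCircuit (by simp [M', Matroid.isthmus])]
      rintro X hX hs
      obtain ⟨C, -, rfl⟩ | ⟨C, hC, -⟩ := Matroid.sum_isCircuit_iff.1 hX
      · simp at hs
      · exact Matroid.not_isthmus_isCircuit C hC
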